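/- There is a universal constant $C>0$ such that the following holds. Let $d\ge 2$, let $\mathcal{D}$ be a probability distribution on $\mathbb{R}^d$ whose support lies in the Euclidean ball of radius $R$ centered at the origin and which has zero mean, and let $\mathbf{Q}=\mathbb{E}_{\mathbf{q}\sim\mathcal{D}}[\mathbf{q}\mathbf{q}^\top]$, with eigenvalues $\lambda_1\ge\lambda_2\ge\dots\ge\lambda_d$ counted with multiplicity and eigengap $\delta=\lambda_1-\lambda_2$. Let $V\ge 0$ and suppose that $\delta\ge V\sqrt{2\lambda_1+V^2}+\varepsilon$ for some $\varepsilon>0$. Let $\mathbf{x}$ be the leading eigenvector of $\mathbf{Q}$ (a unit eigenvector for $\lambda_1$, unique up to sign). Fix $c\in(0,1]$ and suppose in addition that $\delta\ge(32c^{-1}\lambda_1V^4)^{1/3}$. Then for every $p\in(0,1)$ there is an integer $n_0\ge 1$ with $$n_0\le C\,\frac{R^4\lambda_1\log(d/p)}{c\,\delta^3}$$ such that every sample size $n\ge n_0$ suffices in the following sense. Let $\mathbf{x}_t=\mathbf{q}_t+\mathbf{v}_t$ for $t=1,\dots,n$, where $\mathbf{q}_1,\dots,\mathbf{q}_n$ are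 drawn i.i.d. from $\mathcal{D}$ and $\mathbf{v}_1,\dots,\mathbf{v}_n\in\mathbb{R}^d$ are arbitrary fixed (non-random) vectors with $\|\mathbf{v}_t\|_2\le V$. Then with probability at least $1-p$, every leading eigenvector $\hat{\mathbf{w}}_1$ (unit eigenvector for the largest eigenvalue) of the empirical covariance $\hat{\mathbf{X}}=\frac1n\sum_{i=1}^n\mathbf{x}_i\mathbf{x}_i^\top$ satisfies $$(\hat{\mathbf{w}}_1^\top\mathbf{x})^2\ \ge\ 1-c\,\frac{\delta-V^2}{2\lambda_1}.$$ -/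

import Mathlib

open MeasureTheory ProbabilityTheory

noncomputable section

/-- The largest eigenvalue `λ₁(A)` of a real symmetric `d × d` matrix. The list `eigenvalues₀` holds
the eigenvalues with multiplicity, in descending order. -/
def lambdaOne {d : ℕ} (hd : 2 ≤ d) {A : Matrix (Fin d) (Fin d) ℝ} (hA : A.IsHermitian) : ℝ :=
  hA.eigenvalues₀ ⟨0, by rw [Fintype.card_fin]; omega⟩

/-- The second largest eigenvalue `λ₂(A)`, counted with multiplicity. -/
def lambdaTwo {d : ℕ} (hd : 2 ≤ d) {A : Matrix (Fin d) (Fin d) ℝ} (hA : A.IsHermitian) : ℝ :=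
  hA.eigenvalues₀ ⟨1, by rw [Fintype.card_fin]; omega⟩

/-- The eigengap `δ(A) = λ₁(A) - λ₂(A)`. -/
def eigengap {d : ℕ} (hd : 2 ≤ d) {A : Matrix (Fin d) (Fin d) ℝ} (hA : A.IsHermitian) : ℝ :=
  lambdaOne hd hA - lambdaTwo hd hA

/-- `w` is a leading eigenvector of `A`: a unit vector with `A w = λ₁(A) w`. -/
def IsLeadingEigenvector {d : ℕ} (hd : 2 ≤ d) {A : Matrix (Fin d) (Fin d) ℝ}
    (hA : A.IsHermitian) (w : EuclideanSpace ℝ (Fin d)) : Prop :=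
  ‖w‖ = 1 ∧ A.toEuclideanLin w = lambdaOne hd hA • w

/-- The matrix `Q = 𝔼[q qᵀ]`, for `q` distributed according to `D`. -/
def covMatrix {d : ℕ} (D : Measure (EuclideanSpace ℝ (Fin d))) : Matrix (Fin d) (Fin d) ℝ :=
  Matrix.of fun i j => ∫ q, q i * q j ∂D

theorem covMatrix_isHermitian {d : ℕ} (D : Measure (EuclideanSpace ℝ (Fin d))) :
    (covMatrix D).IsHermitian := by
  ext i j
  simp [covMatrix, mul_comm]

/-- The empirical covariance `(1/n) ∑ i, xᵢ xᵢᵀ`. -/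
def empCov {d n : ℕ} (x : Fin n → EuclideanSpace ℝ (Fin d)) : Matrix (Fin d) (Fin d) ℝ :=
  (1 / (n : ℝ)) • ∑ i, Matrix.vecMulVec (x i) (x i)

theorem empCov_isHermitian {d n : ℕ} (x : Fin n → EuclideanSpace ℝ (Fin d)) :
    (empCov x).IsHermitian := by
  ext i j
  simp [empCov, Matrix.sum_apply, Matrix.vecMulVec_apply, mul_comm]

/-- The conditions of the perturbed spiked covariance model on the distribution `D`, with radius `R`
and perturbation level `V`: the support of `D` lies in the ball of radius `R`, `D` has zero mean, and
the eigengap of its covariance is at least `V √(2 λ₁ + V²) + ε` for some `ε > 0`. -/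
structure SpikedDistribution {d : ℕ} (hd : 2 ≤ d) (D : Measure (EuclideanSpace ℝ (Fin d)))
    (R V : ℝ) : Prop where
  level_nonneg : 0 ≤ V
  support_subset : D.support ⊆ Metric.closedBall 0 R
  mean_zero : ∫ q, q ∂D = 0
  gap : ∃ ε : ℝ, 0 < ε ∧
    V * √(2 * lambdaOne hd (covMatrix_isHermitian D) + V ^ 2) + ε
      ≤ eigengap hd (covMatrix_isHermitian D)

/-- The random vectors `x₁, …, x_N` on `(Ω, P)` are of the form `x_t = q_t + v_t`, with `q_t` drawn
i.i.d. from `D` and `v_t` fixed arbitrary vectors of norm at most `V`. -/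
def IsPerturbedSample {d N : ℕ} {Ω : Type*} [MeasurableSpace Ω] (P : Measure Ω)
    (D : Measure (EuclideanSpace ℝ (Fin d))) (V : ℝ)
    (x : Fin N → Ω → EuclideanSpace ℝ (Fin d)) : Prop :=
  ∃ (q : Fin N → Ω → EuclideanSpace ℝ (Fin d)) (v : Fin N → EuclideanSpace ℝ (Fin d)),
    (∀ t, Measurable (q t)) ∧ iIndepFun q P ∧ (∀ t, P.map (q t) = D) ∧
    (∀ t, ‖v t‖ ≤ V) ∧ ∀ t ω, x t ω = q t ω + v t

end

/-! Write `empCov X - Q` as the average of the centred deviations `covDeviation D (v t) (q t)` plus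
the average of the `v t (v t)ᵀ`. The second average has Frobenius norm at most `V ^ 2`. The first is
an average of independent, mean-zero, bounded vectors in the Hilbert space of matrices, so the
dimension-free Hoeffding bound `measure_norm_sum_ge_le` makes it smaller than `η` outside an event
of probability at most `p`.

The Davis–Kahan bound `one_sub_inner_sq_le` then gives squared sine at most `2 (V² + η)² / δ²`. With
`η² = c δ³ / (32 λ₁)`, the cube-root hypothesis says exactly that `V² ≤ η`, so this is at most `8 η²
/ δ² = c δ / (4 λ₁)`. The gap condition yields `V² ≤ δ / 2`, which turns it into the claimed error.
-/

/-! ### Hoeffding's inequality in a Hilbert space, by the `cosh` moment method. -/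

section VectorHoeffding

/-- `cosh z` is a power series in `z ^ 2` with nonnegative coefficients, hence increasing and convex
as a function of `z ^ 2`. -/
lemma Real.cosh_le_chord {z p q α β : ℝ} (hα : 0 ≤ α) (hβ : 0 ≤ β) (hαβ : α + β = 1)
    (h : z ^ 2 ≤ α * p ^ 2 + β * q ^ 2) :
    Real.cosh z ≤ α * Real.cosh p + β * Real.cosh q := by
  refine hasSum_le (fun k => ?_) (Real.hasSum_cosh z)
    (((Real.hasSum_cosh p).mul_left α).add ((Real.hasSum_cosh q).mul_left β))
  have hconv := (convexOn_pow k).2 (Set.mem_Ici.2 (sq_nonneg p)) (Set.mem_Ici.2 (sq_nonneg q))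
    hα hβ hαβ
  simp only [smul_eq_mul] at hconv
  have hk : (z ^ 2) ^ k ≤ α * (p ^ 2) ^ k + β * (q ^ 2) ^ k :=
    (pow_le_pow_left₀ (sq_nonneg z) h k).trans hconv
  rw [pow_mul, pow_mul, pow_mul, ← mul_div_assoc, ← mul_div_assoc, ← add_div]
  gcongr

lemma integrable_cosh_norm_of_ae_bound {E Ω : Type*} [NormedAddCommGroup E] [MeasurableSpace E]
    [OpensMeasurableSpace E] [MeasurableSpace Ω] {P : Measure Ω} [IsFiniteMeasure P] {S : Ω → E} (hS : Measurable S) {K : ℝ}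
    (hK : ∀ᵐ ω ∂P, ‖S ω‖ ≤ K) :
    Integrable (fun ω => Real.cosh ‖S ω‖) P := by
  refine Integrable.of_bound (C := Real.cosh K)
    (Real.continuous_cosh.measurable.comp hS.norm).aestronglyMeasurable ?_
  filter_upwards [hK] with ω hω
  rw [Real.norm_eq_abs, abs_of_pos (Real.cosh_pos _), Real.cosh_le_cosh,
    abs_of_nonneg (norm_nonneg _)]
  exact hω.trans (le_abs_self K)

lemma ae_norm_sum_le {E Ω ι : Type*} [NormedAddCommGroup E] [MeasurableSpace Ω] {P : Measure Ω}
    {Y : ι → Ω → E} {B : ℝ} (hYB : ∀ i, ∀ᵐ ω ∂P, ‖Y i ω‖ ≤ B) (s : Finset ι) :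
    ∀ᵐ ω ∂P, ‖∑ i ∈ s, Y i ω‖ ≤ s.card * B := by
  have h : ∀ᵐ ω ∂P, ∀ i ∈ s, ‖Y i ω‖ ≤ B :=
    (Finset.eventually_all s).2 fun i _ => hYB i
  filter_upwards [h] with ω hω
  exact (norm_sum_le_of_le s hω).trans (by simp)

variable {H : Type*} [NormedAddCommGroup H] [InnerProductSpace ℝ H]

/-- The point is that the correction term is linear in `y`, so it averages to zero for independent
centred `y`. The chord runs between `(a - B) ^ 2` and `(a + B) ^ 2`, with weights chosen so that it
meets `a ^ 2 + B ^ 2 + 2 * u`, which dominates `‖s + y‖ ^ 2`. -/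
lemma cosh_norm_add_le {B : ℝ} (hB : 0 ≤ B) (s y : H) (hy : ‖y‖ ≤ B) :
    Real.cosh ‖s + y‖ ≤ Real.cosh B * Real.cosh ‖s‖ +
      inner ℝ ((Real.sinh ‖s‖ / ‖s‖ * (Real.sinh B / B)) • s) y := by
  set a := ‖s‖ with ha
  set u := inner ℝ s y with hu
  have ha0 : 0 ≤ a := norm_nonneg s
  have hu1 : |u| ≤ a * B := (abs_real_inner_le_norm s y).trans (by gcongr)
  have hr : |u / (a * B)| ≤ 1 := by
    rw [abs_div, abs_of_nonneg (mul_nonneg ha0 hB)]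
    exact div_le_one_of_le₀ hu1 (mul_nonneg ha0 hB)
  -- If `a * B = 0` then `u = 0` too, so the convention `u / 0 = 0` does no harm.
  have hru : u / (a * B) * (a * B) = u := by
    rcases eq_or_ne (a * B) 0 with h0 | h0
    · rw [h0] at hu1 ⊢
      simp [abs_nonpos_iff.1 hu1]
    · exact div_mul_cancel₀ u h0
  obtain ⟨h1, h2⟩ := abs_le.1 hr
  have key := Real.cosh_le_chord (z := ‖s + y‖) (p := a + B) (q := a - B)
    (α := (1 + u / (a * B)) / 2) (β := (1 - u / (a * B)) / 2) (by linarith) (by linarith)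
    (by ring) (by
      have e : (1 + u / (a * B)) / 2 * (a + B) ^ 2 + (1 - u / (a * B)) / 2 * (a - B) ^ 2
          = a ^ 2 + B ^ 2 + 2 * (u / (a * B) * (a * B)) := by ring
      rw [e, hru, norm_add_sq_real]
      nlinarith [norm_nonneg y])
  refine key.trans (le_of_eq ?_)
  rw [real_inner_smul_left, Real.cosh_add, Real.cosh_sub, ← hu]
  ring

variable [CompleteSpace H] [SecondCountableTopology H] [MeasurableSpace H] [BorelSpace H]
  {Ω : Type*} [MeasurableSpace Ω] {P : Measure Ω} [IsProbabilityMeasure P]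

lemma integral_cosh_norm_add_le {S Y : Ω → H} (hS : Measurable S) (hY : Measurable Y)
    (hind : IndepFun S Y P) {B K : ℝ} (hB : 0 ≤ B) (hK : ∀ᵐ ω ∂P, ‖S ω‖ ≤ K)
    (hYB : ∀ᵐ ω ∂P, ‖Y ω‖ ≤ B) (hmean : ∫ ω, Y ω ∂P = 0) :
    ∫ ω, Real.cosh ‖S ω + Y ω‖ ∂P ≤ Real.cosh B * ∫ ω, Real.cosh ‖S ω‖ ∂P := by
  set g : H → H := fun s => (Real.sinh ‖s‖ / ‖s‖ * (Real.sinh B / B)) • s with hg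
  have hgm : Measurable g := by
    have : Measurable Real.sinh := Real.continuous_sinh.measurable
    fun_prop
  have hgS : Integrable (fun ω => g (S ω)) P := by
    refine Integrable.of_bound (C := Real.sinh K * (Real.sinh B / B))
      (hgm.comp hS).aestronglyMeasurable ?_
    filter_upwards [hK] with ω hω
    have hsB : 0 ≤ Real.sinh B / B := div_nonneg (Real.sinh_nonneg_iff.2 hB) hB
    have hs : 0 ≤ Real.sinh ‖S ω‖ := Real.sinh_nonneg_iff.2 (norm_nonneg _)
    rw [hg]
    simp only
    rw [norm_smul, Real.norm_eq_abs, abs_of_nonneg (by positivity), mul_right_comm]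
    gcongr
    rcases eq_or_ne ‖S ω‖ 0 with h0 | h0
    · rw [h0, mul_zero]
      exact Real.sinh_nonneg_iff.2 ((norm_nonneg _).trans hω)
    · rw [div_mul_cancel₀ _ h0]
      exact Real.sinh_le_sinh.2 hω
  have hYi : Integrable Y P := Integrable.of_bound hY.aestronglyMeasurable B hYB
  have hcross : ∫ ω, inner ℝ (g (S ω)) (Y ω) ∂P = 0 := by
    have h : ∫ ω, inner ℝ (g (S ω)) (Y ω) ∂P = inner ℝ (∫ ω, g (S ω) ∂P) (∫ ω, Y ω ∂P) :=
      IndepFun.integral_bilin (X := fun ω => g (S ω)) (Y := Y)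
        (hind.comp hgm measurable_id) hgS hYi (innerSL ℝ)
    rw [h, hmean, inner_zero_right]
  have hci : Integrable (fun ω => inner ℝ (g (S ω)) (Y ω)) P := by
    refine (hgS.norm.mul_const B).mono'
      ((hgm.comp hS).inner hY).aestronglyMeasurable ?_
    filter_upwards [hYB] with ω hω
    exact (norm_inner_le_norm _ _).trans (by gcongr)
  have hcS := integrable_cosh_norm_of_ae_bound hS hK
  calc ∫ ω, Real.cosh ‖S ω + Y ω‖ ∂P
      ≤ ∫ ω, (Real.cosh B * Real.cosh ‖S ω‖ + inner ℝ (g (S ω)) (Y ω)) ∂P := by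
        refine integral_mono_ae (integrable_cosh_norm_of_ae_bound (K := K + B) (hS.add hY) ?_)
          ((hcS.const_mul _).add hci) ?_
        · filter_upwards [hK, hYB] with ω h1 h2
          exact (norm_add_le _ _).trans (add_le_add h1 h2)
        · filter_upwards [hYB] with ω h2
          exact cosh_norm_add_le hB _ _ h2
    _ = _ := by
        rw [integral_add (hcS.const_mul _) hci, hcross, add_zero, integral_const_mul]

variable {ι : Type*} {Y : ι → Ω → H}

lemma integral_cosh_norm_sum_le (hY : ∀ i, Measurable (Y i)) (hind : iIndepFun Y P) {B : ℝ}
    (hB : 0 ≤ B) (hYB : ∀ i, ∀ᵐ ω ∂P, ‖Y i ω‖ ≤ B) (hmean : ∀ i, ∫ ω, Y i ω ∂P = 0)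
    (s : Finset ι) :
    ∫ ω, Real.cosh ‖∑ i ∈ s, Y i ω‖ ∂P ≤ Real.cosh B ^ s.card := by
  classical
  induction s using Finset.induction_on with
  | empty => simp
  | insert i s hi ih =>
    have hi' := hind.indepFun_finsetSum_of_notMem hY hi
    have e : (∑ j ∈ s, Y j) = fun ω => ∑ j ∈ s, Y j ω := by ext; simp
    rw [e] at hi'
    have := integral_cosh_norm_add_le (Finset.measurable_fun_sum s fun j _ => hY j) (hY i) hi' hB
      (ae_norm_sum_le hYB s) (hYB i) (hmean i)
    rw [Finset.card_insert_of_notMem hi, pow_succ']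
    refine le_trans (le_of_eq ?_) (this.trans
      (mul_le_mul_of_nonneg_left ih (Real.cosh_pos B).le))
    simp only [Finset.sum_insert hi, add_comm]

/-- Hoeffding's inequality for sums of bounded independent vectors in a Hilbert space, with a
dimension-free constant. -/
theorem measure_norm_sum_ge_le (hY : ∀ i, Measurable (Y i)) (hind : iIndepFun Y P) {B : ℝ}
    (hB : 0 < B) (hYB : ∀ i, ∀ᵐ ω ∂P, ‖Y i ω‖ ≤ B) (hmean : ∀ i, ∫ ω, Y i ω ∂P = 0)
    {s : Finset ι} (hs : s.Nonempty) {t : ℝ} (ht : 0 ≤ t) :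
    P.real {ω | t ≤ ‖∑ i ∈ s, Y i ω‖} ≤ 2 * Real.exp (-t ^ 2 / (2 * s.card * B ^ 2)) := by
  have hn : (0 : ℝ) < s.card := by exact_mod_cast hs.card_pos
  -- This `l` minimises the Chernoff exponent `s.card * (l * B) ^ 2 / 2 - l * t`.
  set l : ℝ := t / (s.card * B ^ 2) with hl
  have hl0 : 0 ≤ l := by positivity
  have hlind : iIndepFun (fun i ω => l • Y i ω) P :=
    hind.comp (fun _ y => l • y) fun _ => measurable_const_smul l
  have hlm : ∀ i, Measurable fun ω => l • Y i ω := fun i => (hY i).const_smul l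
  have hlB : ∀ i, ∀ᵐ ω ∂P, ‖l • Y i ω‖ ≤ l * B := fun i => by
    filter_upwards [hYB i] with ω hω
    rw [norm_smul, Real.norm_of_nonneg hl0]
    gcongr
  have hE := integral_cosh_norm_sum_le hlm hlind (by positivity) hlB
    (fun i => by rw [integral_smul, hmean, smul_zero]) s
  have hint := integrable_cosh_norm_of_ae_bound
    (Finset.measurable_fun_sum s fun j _ => hlm j) (ae_norm_sum_le hlB s)
  have hmarkov := mul_meas_ge_le_integral_of_nonneg
    (Filter.Eventually.of_forall fun ω => (Real.cosh_pos _).le) hint (Real.exp (l * t) / 2)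
  have hsub : P.real {ω | t ≤ ‖∑ i ∈ s, Y i ω‖} ≤
      P.real {ω | Real.exp (l * t) / 2 ≤ Real.cosh ‖∑ i ∈ s, l • Y i ω‖} := by
    refine measureReal_mono fun ω hω => ?_
    simp only [Set.mem_ofPred_eq] at hω ⊢
    rw [← Finset.smul_sum, norm_smul, Real.norm_of_nonneg hl0, Real.cosh_eq]
    have h1 : Real.exp (l * t) ≤ Real.exp (l * ‖∑ i ∈ s, Y i ω‖) :=
      Real.exp_le_exp.2 (by gcongr)
    have h2 := Real.exp_pos (-(l * ‖∑ i ∈ s, Y i ω‖))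
    linarith
  have hcosh : Real.cosh (l * B) ^ s.card ≤ Real.exp (s.card * ((l * B) ^ 2 / 2)) := by
    rw [Real.exp_nat_mul]
    exact pow_le_pow_left₀ (Real.cosh_pos _).le (Real.cosh_le_exp_half_sq _) _
  have hbound : Real.exp (l * t) / 2 * P.real {ω | t ≤ ‖∑ i ∈ s, Y i ω‖} ≤
      Real.exp (s.card * ((l * B) ^ 2 / 2)) :=
    (mul_le_mul_of_nonneg_left hsub (by positivity)).trans (hmarkov.trans (hE.trans hcosh))
  have hexp : -t ^ 2 / (2 * s.card * B ^ 2) = s.card * ((l * B) ^ 2 / 2) - l * t := by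
    rw [hl]
    field_simp
    ring
  rw [hexp, Real.exp_sub, mul_div_assoc', le_div_iff₀ (Real.exp_pos _)]
  linarith

end VectorHoeffding

/-! ### Quadratic forms in an eigenbasis. -/

section Spectral

namespace Matrix.IsHermitian

variable {d : ℕ} {A : Matrix (Fin d) (Fin d) ℝ} (hA : A.IsHermitian)

lemma toEuclideanLin_eigenvectorBasis (i : Fin d) :
    A.toEuclideanLin (hA.eigenvectorBasis i) = hA.eigenvalues i • hA.eigenvectorBasis i := by
  ext j
  simpa [Matrix.toLpLin_apply] using congrFun (hA.mulVec_eigenvectorBasis i) j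

lemma inner_eigenvectorBasis_toEuclideanLin (w : EuclideanSpace ℝ (Fin d)) (i : Fin d) :
    inner ℝ (hA.eigenvectorBasis i) (A.toEuclideanLin w) =
      hA.eigenvalues i * inner ℝ (hA.eigenvectorBasis i) w := by
  have hsymm := Matrix.isSymmetric_toEuclideanLin_iff.mpr hA
  rw [← hsymm, hA.toEuclideanLin_eigenvectorBasis, real_inner_smul_left]

lemma inner_toEuclideanLin_self (w : EuclideanSpace ℝ (Fin d)) :
    inner ℝ w (A.toEuclideanLin w) =
      ∑ i, hA.eigenvalues i * inner ℝ (hA.eigenvectorBasis i) w ^ 2 := by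
  rw [← hA.eigenvectorBasis.sum_inner_mul_inner]
  refine Finset.sum_congr rfl fun i _ => ?_
  rw [hA.inner_eigenvectorBasis_toEuclideanLin, real_inner_comm]
  ring

lemma sum_inner_eigenvectorBasis_sq (w : EuclideanSpace ℝ (Fin d)) :
    ∑ i, inner ℝ (hA.eigenvectorBasis i) w ^ 2 = ‖w‖ ^ 2 := by
  rw [← hA.eigenvectorBasis.sum_sq_norm_inner_right w]
  simp

end Matrix.IsHermitian

variable {d : ℕ} (hd : 2 ≤ d) {A : Matrix (Fin d) (Fin d) ℝ} (hA : A.IsHermitian)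

/-- Singling out an index rather than a value respects multiplicity: if the top eigenvalue is
repeated, the other copies are bounded by `lambdaTwo`, which then equals it. -/
lemma exists_eigenvalues_eq_lambdaOne :
    ∃ i₀, hA.eigenvalues i₀ = lambdaOne hd hA ∧
      ∀ i, i ≠ i₀ → hA.eigenvalues i ≤ lambdaTwo hd hA := by
  set e : Fin (Fintype.card (Fin d)) ≃ Fin d := Fintype.equivOfCardEq (Fintype.card_fin _)
  refine ⟨e ⟨0, by rw [Fintype.card_fin]; omega⟩, ?_, fun i hi => ?_⟩
  · simp [Matrix.IsHermitian.eigenvalues, lambdaOne, e]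
  · refine hA.eigenvalues₀_antitone ?_
    rw [Fin.le_def]
    refine Nat.one_le_iff_ne_zero.2 fun h => hi ?_
    rw [← e.symm_apply_eq]
    exact Fin.ext h

lemma lambdaTwo_le_lambdaOne : lambdaTwo hd hA ≤ lambdaOne hd hA :=
  hA.eigenvalues₀_antitone (Fin.le_def.2 (Nat.zero_le _))

lemma exists_eigenvalues_eq_lambdaTwo : ∃ i, hA.eigenvalues i = lambdaTwo hd hA :=
  ⟨Fintype.equivOfCardEq (Fintype.card_fin _) ⟨1, by rw [Fintype.card_fin]; omega⟩, by
    simp [Matrix.IsHermitian.eigenvalues, lambdaTwo]⟩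

lemma inner_toEuclideanLin_self_le (w : EuclideanSpace ℝ (Fin d)) :
    inner ℝ w (A.toEuclideanLin w) ≤ lambdaOne hd hA * ‖w‖ ^ 2 := by
  obtain ⟨i₀, h0, h1⟩ := exists_eigenvalues_eq_lambdaOne hd hA
  rw [hA.inner_toEuclideanLin_self, ← hA.sum_inner_eigenvectorBasis_sq, Finset.mul_sum]
  refine Finset.sum_le_sum fun i _ => mul_le_mul_of_nonneg_right ?_ (sq_nonneg _)
  rcases eq_or_ne i i₀ with rfl | hi
  · exact h0.le
  · exact (h1 i hi).trans (lambdaTwo_le_lambdaOne hd hA)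

lemma IsLeadingEigenvector.inner_toEuclideanLin {x : EuclideanSpace ℝ (Fin d)}
    (hx : IsLeadingEigenvector hd hA x) :
    inner ℝ x (A.toEuclideanLin x) = lambdaOne hd hA := by
  rw [hx.2, real_inner_smul_right, real_inner_self_eq_norm_sq, hx.1]
  simp

/-- A unit vector's quadratic form falls short of `λ₁` by the eigengap times its squared sine to the
leading eigenvector. -/
lemma eigengap_mul_le {x w : EuclideanSpace ℝ (Fin d)} (hgap : 0 < eigengap hd hA)
    (hx : IsLeadingEigenvector hd hA x) (hw : ‖w‖ = 1) :
    eigengap hd hA * (1 - inner ℝ w x ^ 2) ≤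
      lambdaOne hd hA - inner ℝ w (A.toEuclideanLin w) := by
  obtain ⟨i₀, h0, h1⟩ := exists_eigenvalues_eq_lambdaOne hd hA
  set b := hA.eigenvectorBasis
  unfold eigengap at hgap ⊢
  -- The positive gap makes `λ₁` simple, so `x` is `± b i₀`.
  have hzero : ∀ i, i ≠ i₀ → inner ℝ (b i) x = 0 := fun i hi => by
    have h := hA.inner_eigenvectorBasis_toEuclideanLin x i
    rw [hx.2, real_inner_smul_right] at h
    have h' : (lambdaOne hd hA - hA.eigenvalues i) * inner ℝ (b i) x = 0 := by
      rw [sub_mul, h, sub_self]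
    refine (mul_eq_zero.1 h').resolve_left (ne_of_gt ?_)
    linarith [h1 i hi]
  have hx0 : inner ℝ (b i₀) x ^ 2 = 1 := by
    have h := hA.sum_inner_eigenvectorBasis_sq x
    rw [Finset.sum_eq_single i₀ (fun i _ hi => by rw [hzero i hi]; simp) (by simp), hx.1] at h
    simpa using h
  have hwx : inner ℝ w x ^ 2 = inner ℝ (b i₀) w ^ 2 := by
    rw [← b.sum_inner_mul_inner, Finset.sum_eq_single i₀
      (fun i _ hi => by rw [hzero i hi]; simp) (by simp), mul_pow, hx0, mul_one, real_inner_comm]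
  have hquad : inner ℝ w (A.toEuclideanLin w) ≤
      lambdaTwo hd hA * ‖w‖ ^ 2 + (lambdaOne hd hA - lambdaTwo hd hA) * inner ℝ (b i₀) w ^ 2 := by
    rw [hA.inner_toEuclideanLin_self, ← hA.sum_inner_eigenvectorBasis_sq, Finset.mul_sum,
      ← Finset.add_sum_erase _ _ (Finset.mem_univ i₀), ← Finset.add_sum_erase _ _ (Finset.mem_univ i₀),
      h0]
    have : ∑ i ∈ Finset.univ.erase i₀, hA.eigenvalues i * inner ℝ (b i) w ^ 2 ≤
        ∑ i ∈ Finset.univ.erase i₀, lambdaTwo hd hA * inner ℝ (b i) w ^ 2 :=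
      Finset.sum_le_sum fun i hi => mul_le_mul_of_nonneg_right
        (h1 i (Finset.ne_of_mem_erase hi)) (sq_nonneg _)
    linarith
  rw [hw] at hquad
  rw [hwx]
  linarith

end Spectral

/-! ### Frobenius geometry of outer products and the Davis–Kahan bound. -/

noncomputable section OuterProduct

variable {d : ℕ}

/-- The outer product `a bᵀ`, as a vector in the Hilbert space of `d × d` matrices with the
Frobenius inner product. -/
def outerProd (a b : EuclideanSpace ℝ (Fin d)) : EuclideanSpace ℝ (Fin d × Fin d) :=
  WithLp.toLp 2 fun ij => a ij.1 * b ij.2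

/-- A matrix, as a vector in the Hilbert space of matrices with the Frobenius inner product. -/
def frobeniusVec (A : Matrix (Fin d) (Fin d) ℝ) : EuclideanSpace ℝ (Fin d × Fin d) :=
  WithLp.toLp 2 fun ij => A ij.1 ij.2

@[simp] lemma outerProd_apply (a b : EuclideanSpace ℝ (Fin d)) (ij : Fin d × Fin d) :
    outerProd a b ij = a ij.1 * b ij.2 := rfl

@[simp] lemma frobeniusVec_apply (A : Matrix (Fin d) (Fin d) ℝ) (ij : Fin d × Fin d) :
    frobeniusVec A ij = A ij.1 ij.2 := rfl

lemma inner_outerProd_outerProd (a b a' b' : EuclideanSpace ℝ (Fin d)) :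
    inner ℝ (outerProd a b) (outerProd a' b') = inner ℝ a a' * inner ℝ b b' := by
  simp only [PiLp.inner_apply, outerProd_apply, RCLike.inner_apply, conj_trivial,
    Fintype.sum_prod_type, Finset.sum_mul_sum]
  exact Finset.sum_congr rfl fun i _ => Finset.sum_congr rfl fun j _ => by ring

lemma norm_outerProd (a b : EuclideanSpace ℝ (Fin d)) : ‖outerProd a b‖ = ‖a‖ * ‖b‖ := by
  rw [← sq_eq_sq₀ (norm_nonneg _) (by positivity), ← real_inner_self_eq_norm_sq,
    inner_outerProd_outerProd, real_inner_self_eq_norm_sq, real_inner_self_eq_norm_sq, mul_pow]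

lemma inner_frobeniusVec_outerProd (A : Matrix (Fin d) (Fin d) ℝ)
    (w : EuclideanSpace ℝ (Fin d)) :
    inner ℝ (frobeniusVec A) (outerProd w w) = inner ℝ w (A.toEuclideanLin w) := by
  simp only [PiLp.inner_apply, outerProd_apply, frobeniusVec_apply, RCLike.inner_apply,
    conj_trivial, Fintype.sum_prod_type, Matrix.toLpLin_apply, Matrix.mulVec, dotProduct,
    Finset.sum_mul]
  exact Finset.sum_congr rfl fun i _ => Finset.sum_congr rfl fun j _ => by ring

lemma continuous_outerProd :
    Continuous fun p : EuclideanSpace ℝ (Fin d) × EuclideanSpace ℝ (Fin d) =>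
      outerProd p.1 p.2 := by
  unfold outerProd
  fun_prop

lemma frobeniusVec_empCov {n : ℕ} (x : Fin n → EuclideanSpace ℝ (Fin d)) :
    frobeniusVec (empCov x) = (1 / (n : ℝ)) • ∑ i, outerProd (x i) (x i) := by
  ext ij
  simp [empCov, Matrix.sum_apply, Matrix.vecMulVec_apply]

/-- Davis–Kahan type bound: the squared sine between the leading eigenvectors of `A` and `B` is at
most `2 ‖B - A‖² / δ(A)²`, in Frobenius norm. -/
lemma one_sub_inner_sq_le (hd : 2 ≤ d) {A B : Matrix (Fin d) (Fin d) ℝ} (hA : A.IsHermitian)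
    (hB : B.IsHermitian) {x w : EuclideanSpace ℝ (Fin d)} (hgap : 0 < eigengap hd hA)
    (hx : IsLeadingEigenvector hd hA x) (hw : IsLeadingEigenvector hd hB w) :
    1 - inner ℝ w x ^ 2 ≤ 2 * ‖frobeniusVec B - frobeniusVec A‖ ^ 2 / eigengap hd hA ^ 2 := by
  set F := frobeniusVec B - frobeniusVec A with hF
  set s : ℝ := 1 - inner ℝ w x ^ 2 with hs
  have h1 := eigengap_mul_le hd hA hgap hx hw.1
  have h2 : inner ℝ F (outerProd w w - outerProd x x) =
      inner ℝ w (B.toEuclideanLin w) - inner ℝ x (B.toEuclideanLin x)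
        - inner ℝ w (A.toEuclideanLin w) + inner ℝ x (A.toEuclideanLin x) := by
    rw [hF, inner_sub_left, inner_sub_right, inner_sub_right, inner_frobeniusVec_outerProd, inner_frobeniusVec_outerProd,
      inner_frobeniusVec_outerProd, inner_frobeniusVec_outerProd]
    ring
  have h3 := inner_toEuclideanLin_self_le hd hB x
  rw [hx.1, one_pow, mul_one, ← hw.inner_toEuclideanLin] at h3
  rw [← hx.inner_toEuclideanLin] at h1
  have h4 : ‖outerProd w w - outerProd x x‖ ^ 2 = 2 * s := by
    rw [norm_sub_sq_real, norm_outerProd, norm_outerProd, inner_outerProd_outerProd, hw.1, hx.1, hs]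
    ring
  -- Since `w` maximises the quadratic form of `B` over unit vectors, the `B` terms of `h2`
  -- contribute a nonnegative amount; by `h1` the `A` terms contribute at least `δ s`.
  have h5 : eigengap hd hA * s ≤ ‖F‖ * ‖outerProd w w - outerProd x x‖ := by
    refine le_trans ?_ (real_inner_le_norm _ _)
    linarith
  have hs0 : 0 ≤ s := by
    have := sq_nonneg ‖outerProd w w - outerProd x x‖
    linarith
  have h6 : (eigengap hd hA * s) ^ 2 ≤ ‖F‖ ^ 2 * (2 * s) := by
    rw [← h4, ← mul_pow]
    exact pow_le_pow_left₀ (by positivity) h5 2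
  rcases hs0.eq_or_lt with h0 | h0
  · rw [← h0]
    positivity
  · rw [le_div_iff₀ (by positivity)]
    refine le_of_mul_le_mul_right ?_ h0
    linarith

end OuterProduct

/-! ### Mean and size of the deviations. -/

noncomputable section Covariance

variable {d : ℕ} {D : Measure (EuclideanSpace ℝ (Fin d))}

lemma ae_norm_le_of_support_subset {R : ℝ} (h : D.support ⊆ Metric.closedBall 0 R) :
    ∀ᵐ q ∂D, ‖q‖ ≤ R := by
  filter_upwards [Measure.support_mem_ae (μ := D)] with q hq
  simpa using h hq

/-- The deviation of `(q + v)(q + v)ᵀ` from its mean `Q + v vᵀ`. -/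
def covDeviation (D : Measure (EuclideanSpace ℝ (Fin d)))
    (v q : EuclideanSpace ℝ (Fin d)) :
    EuclideanSpace ℝ (Fin d × Fin d) :=
  outerProd q q - frobeniusVec (covMatrix D) + (outerProd q v + outerProd v q)

lemma outerProd_add_self (v q : EuclideanSpace ℝ (Fin d)) :
    outerProd (q + v) (q + v) =
      covDeviation D v q + outerProd v v + frobeniusVec (covMatrix D) := by
  ext ij
  simp [covDeviation]
  ring

lemma continuous_covDeviation (v : EuclideanSpace ℝ (Fin d)) : Continuous (covDeviation D v) := by
  unfold covDeviation outerProd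
  fun_prop

variable [IsProbabilityMeasure D] {R : ℝ}

lemma integrable_outerProd (hR : ∀ᵐ q ∂D, ‖q‖ ≤ R) :
    Integrable (fun q => outerProd q q) D := by
  have hc : Continuous fun q : EuclideanSpace ℝ (Fin d) => outerProd q q :=
    continuous_outerProd.comp (continuous_id.prodMk continuous_id)
  refine Integrable.of_bound (C := R * R) hc.aestronglyMeasurable ?_
  filter_upwards [hR] with q hq
  rw [norm_outerProd]
  gcongr
  exact (norm_nonneg _).trans hq

lemma integral_outerProd (hR : ∀ᵐ q ∂D, ‖q‖ ≤ R) :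
    ∫ q, outerProd q q ∂D = frobeniusVec (covMatrix D) := by
  ext ij
  have h := (EuclideanSpace.proj (𝕜 := ℝ) ij).integral_comp_comm (integrable_outerProd hR)
  simpa [covMatrix] using h.symm

lemma norm_frobeniusVec_covMatrix_le (hR : ∀ᵐ q ∂D, ‖q‖ ≤ R) :
    ‖frobeniusVec (covMatrix D)‖ ≤ R ^ 2 := by
  rw [← integral_outerProd hR]
  refine (norm_integral_le_of_norm_le_const (C := R ^ 2) ?_).trans (by simp)
  filter_upwards [hR] with q hq
  rw [norm_outerProd, ← sq]
  gcongr

lemma inner_toEuclideanLin_covMatrix_nonneg (hR : ∀ᵐ q ∂D, ‖q‖ ≤ R)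
    (w : EuclideanSpace ℝ (Fin d)) : 0 ≤ inner ℝ w ((covMatrix D).toEuclideanLin w) := by
  rw [← inner_frobeniusVec_outerProd, ← integral_outerProd hR, real_inner_comm,
    ← integral_inner (integrable_outerProd hR)]
  refine integral_nonneg fun q => ?_
  simp only [inner_outerProd_outerProd]
  exact mul_self_nonneg _

lemma lambdaTwo_covMatrix_nonneg (hd : 2 ≤ d) (hR : ∀ᵐ q ∂D, ‖q‖ ≤ R) :
    0 ≤ lambdaTwo hd (covMatrix_isHermitian D) := by
  obtain ⟨i, hi⟩ := exists_eigenvalues_eq_lambdaTwo hd (covMatrix_isHermitian D)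
  have h := inner_toEuclideanLin_covMatrix_nonneg hR
    ((covMatrix_isHermitian D).eigenvectorBasis i)
  rw [(covMatrix_isHermitian D).toEuclideanLin_eigenvectorBasis, real_inner_smul_right,
    real_inner_self_eq_norm_sq, OrthonormalBasis.norm_eq_one, hi] at h
  simpa using h

lemma lambdaOne_covMatrix_le (hd : 2 ≤ d) (hR : ∀ᵐ q ∂D, ‖q‖ ≤ R)
    {x : EuclideanSpace ℝ (Fin d)} (hx : IsLeadingEigenvector hd (covMatrix_isHermitian D) x) :
    lambdaOne hd (covMatrix_isHermitian D) ≤ R ^ 2 := by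
  rw [← hx.inner_toEuclideanLin, ← inner_frobeniusVec_outerProd]
  refine (real_inner_le_norm _ _).trans ?_
  rw [norm_outerProd, hx.1]
  simpa using norm_frobeniusVec_covMatrix_le hR

lemma norm_covDeviation_le (hR : ∀ᵐ q ∂D, ‖q‖ ≤ R) {v : EuclideanSpace ℝ (Fin d)} (hv : ‖v‖ ≤ R) :
    ∀ᵐ q ∂D, ‖covDeviation D v q‖ ≤ 4 * R ^ 2 := by
  have hQ := norm_frobeniusVec_covMatrix_le hR
  filter_upwards [hR] with q hq
  have hR0 : 0 ≤ R := (norm_nonneg _).trans hv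
  have hqq : ‖outerProd q q‖ ≤ R ^ 2 := by
    rw [norm_outerProd, sq]
    gcongr
  have hqv : ‖outerProd q v‖ ≤ R ^ 2 := by
    rw [norm_outerProd, sq]
    gcongr
  have hvq : ‖outerProd v q‖ ≤ R ^ 2 := by
    rw [norm_outerProd, sq]
    gcongr
  have h1 := norm_add_le (outerProd q q - frobeniusVec (covMatrix D))
    (outerProd q v + outerProd v q)
  have h2 := norm_sub_le (outerProd q q) (frobeniusVec (covMatrix D))
  have h3 := norm_add_le (outerProd q v) (outerProd v q)
  unfold covDeviation
  linarith

lemma integral_covDeviation (hR : ∀ᵐ q ∂D, ‖q‖ ≤ R) (hmean : ∫ q, q ∂D = 0)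
    (v : EuclideanSpace ℝ (Fin d)) : ∫ q, covDeviation D v q ∂D = 0 := by
  have hid : Integrable (fun q => q) D := Integrable.of_bound (by fun_prop) R hR
  -- The cross terms `q vᵀ + v qᵀ` are linear in `q`, so zero mean kills them for every fixed `v`.
  have hL (L : EuclideanSpace ℝ (Fin d) →ₗ[ℝ] EuclideanSpace ℝ (Fin d × Fin d)) :
      Integrable (fun q => L q) D ∧ ∫ q, L q ∂D = 0 := by
    refine ⟨L.toContinuousLinearMap.integrable_comp hid, ?_⟩
    have h := L.toContinuousLinearMap.integral_comp_comm hid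
    rw [hmean, map_zero] at h
    exact h
  obtain ⟨hi1, h1⟩ := hL
    { toFun := fun q => outerProd q v + outerProd v q
      map_add' := fun a b => by ext; simp; ring
      map_smul' := fun c a => by ext; simp; ring }
  simp only [LinearMap.coe_mk, AddHom.coe_mk] at hi1 h1
  have hqq := integrable_outerProd hR
  have hsub : Integrable (fun q => outerProd q q - frobeniusVec (covMatrix D)) D :=
    hqq.sub (integrable_const _)
  unfold covDeviation
  rw [integral_add hsub hi1, integral_sub hqq (integrable_const _), h1,
    integral_outerProd hR]
  simp

end Covariance

/-! ### Recovery on the good event, concentration, and the choice of constants. -/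

section Recovery

/-- Deterministic recovery: a small average deviation from the mean forces the empirical leading
eigenvector to be close to the population one. -/
lemma one_sub_inner_sq_le_of_norm_sum_covDeviation_le {d n : ℕ} (hd : 2 ≤ d) (hn : 0 < n)
    {D : Measure (EuclideanSpace ℝ (Fin d))} {V η : ℝ}
    {q v X : Fin n → EuclideanSpace ℝ (Fin d)} (hX : ∀ t, X t = q t + v t)
    (hv : ∀ t, ‖v t‖ ≤ V) (hη : ‖∑ t, covDeviation D (v t) (q t)‖ ≤ n * η)
    {x w : EuclideanSpace ℝ (Fin d)} (hgap : 0 < eigengap hd (covMatrix_isHermitian D))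
    (hx : IsLeadingEigenvector hd (covMatrix_isHermitian D) x)
    (hw : IsLeadingEigenvector hd (empCov_isHermitian X) w) :
    1 - inner ℝ w x ^ 2 ≤
      2 * (V ^ 2 + η) ^ 2 / eigengap hd (covMatrix_isHermitian D) ^ 2 := by
  have hn' : (0 : ℝ) < n := by exact_mod_cast hn
  refine (one_sub_inner_sq_le hd _ _ hgap hx hw).trans ?_
  have hF : frobeniusVec (empCov X) - frobeniusVec (covMatrix D) =
      (1 / (n : ℝ)) • (∑ t, covDeviation D (v t) (q t) + ∑ t, outerProd (v t) (v t)) := by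
    simp only [frobeniusVec_empCov, hX, outerProd_add_self (D := D), Finset.sum_add_distrib,
      Finset.sum_const, Finset.card_univ, Fintype.card_fin]
    rw [smul_add _ _ ((n : ℕ) • _), ← Nat.cast_smul_eq_nsmul ℝ, smul_smul,
      one_div_mul_cancel hn'.ne', one_smul, add_sub_cancel_right]
  have hV : ‖∑ t, outerProd (v t) (v t)‖ ≤ n * V ^ 2 := by
    have h : ∀ t ∈ Finset.univ, ‖outerProd (v t) (v t)‖ ≤ V ^ 2 := fun t _ => by
      rw [norm_outerProd, ← sq]
      exact pow_le_pow_left₀ (norm_nonneg _) (hv t) 2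
    exact (norm_sum_le_of_le _ h).trans_eq (by simp)
  have hnorm : ‖frobeniusVec (empCov X) - frobeniusVec (covMatrix D)‖ ≤ V ^ 2 + η := by
    rw [hF, norm_smul, Real.norm_of_nonneg (by positivity), one_div, inv_mul_le_iff₀ hn']
    refine (norm_add_le _ _).trans ?_
    linarith
  gcongr

/-- The deviations of the perturbed sample concentrate around zero. -/
lemma measure_norm_sum_covDeviation_ge_le {d n : ℕ} (hn : 0 < n)
    {D : Measure (EuclideanSpace ℝ (Fin d))} [IsProbabilityMeasure D] {R η : ℝ} (hRpos : 0 < R)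
    (hη : 0 ≤ η) (hR : ∀ᵐ q ∂D, ‖q‖ ≤ R) (hmean : ∫ q, q ∂D = 0) {Ω : Type*} [MeasurableSpace Ω]
    {P : Measure Ω} [IsProbabilityMeasure P] {q : Fin n → Ω → EuclideanSpace ℝ (Fin d)}
    {v : Fin n → EuclideanSpace ℝ (Fin d)} (hq : ∀ t, Measurable (q t)) (hind : iIndepFun q P)
    (hmap : ∀ t, P.map (q t) = D) (hv : ∀ t, ‖v t‖ ≤ R) :
    P.real {ω | n * η ≤ ‖∑ t, covDeviation D (v t) (q t ω)‖} ≤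
      2 * Real.exp (-(n * η ^ 2 / (32 * R ^ 4))) := by
  have hn' : (0 : ℝ) < n := by exact_mod_cast hn
  have : Nonempty (Fin n) := ⟨⟨0, hn⟩⟩
  have hZm (t : Fin n) : Measurable (covDeviation D (v t)) :=
    (continuous_covDeviation (v t)).measurable
  have h := measure_norm_sum_ge_le (P := P) (Y := fun t ω => covDeviation D (v t) (q t ω))
    (fun t => (hZm t).comp (hq t)) (hind.comp _ hZm) (B := 4 * R ^ 2) (by positivity)
    (fun t => by
      have h := norm_covDeviation_le hR (hv t)
      conv at h in ae D => rw [← hmap t]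
      exact ae_of_ae_map (hq t).aemeasurable h)
    (fun t => by
      have h := integral_covDeviation hR hmean (v t)
      conv_lhs at h => rw [← hmap t]
      rw [integral_map (hq t).aemeasurable (by
        exact (continuous_covDeviation (v t)).aestronglyMeasurable)] at h
      rw [← h]
      simp only [hmap t])
    Finset.univ_nonempty (t := n * η) (by positivity)
  refine h.trans (le_of_eq ?_)
  rw [Finset.card_univ, Fintype.card_fin]
  congr 2
  field_simp
  ring

lemma perturbation_bound_le {lam V c δ η : ℝ} (hlam : 0 < lam) (hc : 0 < c) (hδ : 0 < δ)
    (hV : V ^ 2 ≤ δ / 2) (hV4 : 32 * c⁻¹ * lam * V ^ 4 ≤ δ ^ 3)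
    (hη : η ^ 2 = c * δ ^ 3 / (32 * lam)) :
    2 * (V ^ 2 + η) ^ 2 / δ ^ 2 ≤ c * ((δ - V ^ 2) / (2 * lam)) := by
  have h1 : V ^ 4 ≤ c * δ ^ 3 / (32 * lam) := by
    rw [le_div_iff₀ (by positivity)]
    have := mul_le_mul_of_nonneg_left hV4 hc.le
    have e : c * (32 * c⁻¹ * lam * V ^ 4) = V ^ 4 * (32 * lam) := by
      field_simp
    linarith
  have h2 : 2 * (V ^ 2 + η) ^ 2 ≤ 8 * (c * δ ^ 3 / (32 * lam)) := by
    nlinarith [sq_nonneg (V ^ 2 - η)]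
  calc 2 * (V ^ 2 + η) ^ 2 / δ ^ 2 ≤ 8 * (c * δ ^ 3 / (32 * lam)) / δ ^ 2 := by gcongr
    _ = c * ((δ / 2) / (2 * lam)) := by field_simp; ring
    _ ≤ c * ((δ - V ^ 2) / (2 * lam)) := by gcongr; linarith

/-- Squaring the gap condition gives `2 λ V² ≤ δ²`, and `δ ≤ λ` lets one factor of `δ` cancel. -/
lemma sq_le_half_of_mul_sqrt_le {lam V δ : ℝ} (hV : 0 ≤ V) (hδ : 0 < δ) (hδlam : δ ≤ lam)
    (h : V * √(2 * lam + V ^ 2) ≤ δ) : V ^ 2 ≤ δ / 2 := by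
  have hnn : 0 ≤ 2 * lam + V ^ 2 := by linarith [sq_nonneg V]
  have h1 : V ^ 2 * (2 * lam + V ^ 2) ≤ δ ^ 2 := by
    have := pow_le_pow_left₀ (mul_nonneg hV (Real.sqrt_nonneg _)) h 2
    rwa [mul_pow, Real.sq_sqrt hnn] at this
  have h2 : V ^ 2 * (2 * δ) ≤ δ * δ := by nlinarith [sq_nonneg V, sq_nonneg (V ^ 2)]
  have h3 : V ^ 2 * 2 ≤ δ := le_of_mul_le_mul_right (by linarith) hδ
  linarith

end Recovery

theorem lemma1 :
    ∃ C : ℝ, 0 < C ∧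
      ∀ (d : ℕ) (hd : 2 ≤ d) (D : Measure (EuclideanSpace ℝ (Fin d))) [IsProbabilityMeasure D]
        (R V c p lam₁ δ : ℝ) (x : EuclideanSpace ℝ (Fin d)),
        lam₁ = lambdaOne hd (covMatrix_isHermitian D) →
        δ = eigengap hd (covMatrix_isHermitian D) →
        IsLeadingEigenvector hd (covMatrix_isHermitian D) x →
        SpikedDistribution hd D R V →
        0 < c → c ≤ 1 →
        (32 * c⁻¹ * lam₁ * V ^ 4) ^ (1 / 3 : ℝ) ≤ δ →
        0 < p → p < 1 →
        ∃ n₀ : ℕ, 1 ≤ n₀ ∧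
          (n₀ : ℝ) ≤ C * (R ^ 4 * lam₁ * Real.log (d / p) / (c * δ ^ 3)) ∧
          ∀ (n : ℕ), n₀ ≤ n →
            ∀ (Ω : Type*) [MeasurableSpace Ω] (P : Measure Ω) [IsProbabilityMeasure P]
              (X : Fin n → Ω → EuclideanSpace ℝ (Fin d)),
              IsPerturbedSample P D V X →
              ∃ A : Set Ω, MeasurableSet A ∧ ENNReal.ofReal (1 - p) ≤ P A ∧
                ∀ ω ∈ A, ∀ w : EuclideanSpace ℝ (Fin d),
                  IsLeadingEigenvector hd (empCov_isHermitian fun i => X i ω) w →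
                  1 - c * ((δ - V ^ 2) / (2 * lam₁)) ≤ (inner ℝ w x) ^ 2 := by
  -- The sample size is `⌈1024 K⌉₊ < 1024 K + 1`, and `K ≥ 1 / 2` absorbs the `1` into `2 K`.
  refine ⟨1026, by norm_num, ?_⟩
  intro d hd D _ R V c p lam₁ δ x hlam hδ hx hD hc hc1 hrpow hp hp1
  obtain ⟨hV, hsupp, hmean, ε, hε, hgap⟩ := hD
  have hR := ae_norm_le_of_support_subset hsupp
  have hlamR : lam₁ ≤ R ^ 2 := hlam ▸ lambdaOne_covMatrix_le hd hR hx
  have hlam2 := lambdaTwo_covMatrix_nonneg hd hR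
  have hδlam : δ ≤ lam₁ := by
    rw [hδ, hlam, eigengap]
    linarith
  rw [← hlam, ← hδ] at hgap
  have hδ0 : 0 < δ := by
    have := mul_nonneg hV (Real.sqrt_nonneg (2 * lam₁ + V ^ 2))
    linarith
  have hlam0 : 0 < lam₁ := hδ0.trans_le hδlam
  have hR0 : 0 < R := by
    obtain ⟨q, hq⟩ := hR.exists
    refine ((norm_nonneg q).trans hq).lt_of_ne fun h => ?_
    rw [← h] at hlamR
    norm_num at hlamR
    linarith
  have hV2 : V ^ 2 ≤ δ / 2 := sq_le_half_of_mul_sqrt_le hV hδ0 hδlam (by linarith)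
  have hVR : V ≤ R := by
    refine le_of_sq_le_sq ?_ hR0.le
    linarith
  have hV4 : 32 * c⁻¹ * lam₁ * V ^ 4 ≤ δ ^ 3 := by
    have h0 : 0 ≤ 32 * c⁻¹ * lam₁ * V ^ 4 := by positivity
    have h := pow_le_pow_left₀ (Real.rpow_nonneg h0 _) hrpow 3
    rwa [← Real.rpow_natCast, ← Real.rpow_mul h0, Nat.cast_ofNat,
      one_div_mul_cancel (by norm_num), Real.rpow_one] at h
  have hd2 : (2 : ℝ) ≤ d := by exact_mod_cast hd
  have hdp : 2 ≤ (d : ℝ) / p := by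
    rw [le_div_iff₀ hp]
    linarith
  have hlog : 1 / 2 ≤ Real.log (d / p) := by
    have := Real.log_le_log (by norm_num) hdp
    have := Real.log_two_gt_d9
    linarith
  set L := Real.log (d / p) with hL
  set K := R ^ 4 * lam₁ * L / (c * δ ^ 3) with hK
  -- Uses `c ≤ 1`, `L ≥ 1 / 2` and `δ ≤ λ₁ ≤ R ^ 2`.
  have hK2 : 1 / 2 ≤ K := by
    rw [hK, le_div_iff₀ (by positivity)]
    have h1 : lam₁ ^ 2 ≤ R ^ 4 := by
      calc lam₁ ^ 2 ≤ (R ^ 2) ^ 2 := by gcongr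
        _ = R ^ 4 := by ring
    calc 1 / 2 * (c * δ ^ 3) ≤ L * (1 * lam₁ ^ 3) := by gcongr
      _ = lam₁ ^ 2 * lam₁ * L := by ring
      _ ≤ R ^ 4 * lam₁ * L := by gcongr
  refine ⟨⌈1024 * K⌉₊, Nat.one_le_ceil_iff.2 (by positivity), ?_, ?_⟩
  · have := Nat.ceil_lt_add_one (a := 1024 * K) (by positivity)
    linarith
  intro n hn Ω _ P _ X hX
  obtain ⟨q, v, hq, hind, hmap, hv, hXt⟩ := hX
  have hn0 : 0 < n := (Nat.one_le_ceil_iff.2 (by positivity : 0 < 1024 * K)).trans hn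
  have hnK : 1024 * K ≤ n := Nat.ceil_le.1 hn
  set η : ℝ := √(c * δ ^ 3 / (32 * lam₁)) with hη
  have hη2 : η ^ 2 = c * δ ^ 3 / (32 * lam₁) := Real.sq_sqrt (by positivity)
  set Bad : Set Ω := {ω | n * η ≤ ‖∑ t, covDeviation D (v t) (q t ω)‖} with hBad
  have hBadm : MeasurableSet Bad := by
    refine measurableSet_le measurable_const (Measurable.norm ?_)
    exact Finset.measurable_fun_sum _ fun t _ =>
      (continuous_covDeviation (v t)).measurable.comp (hq t)
  have hBadp : P.real Bad ≤ p := by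
    refine (measure_norm_sum_covDeviation_ge_le hn0 hR0 (Real.sqrt_nonneg _) hR hmean hq hind hmap
      fun t => (hv t).trans hVR).trans ?_
    -- Here `1024 = 32 * 32`: one factor from the Hoeffding exponent with `B = 4 * R ^ 2`, the other
    -- from the definition of `η`.
    have hexp : L ≤ n * η ^ 2 / (32 * R ^ 4) := by
      calc L = 1024 * K * η ^ 2 / (32 * R ^ 4) := by
            rw [hη2, hK]
            field_simp
            norm_num
        _ ≤ n * η ^ 2 / (32 * R ^ 4) := by gcongr
    calc 2 * Real.exp (-(n * η ^ 2 / (32 * R ^ 4))) ≤ 2 * Real.exp (-L) := by gcongr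
      _ = 2 * (p / d) := by
        rw [Real.exp_neg, hL, Real.exp_log (by positivity), inv_div]
      -- The dimension only serves to absorb Hoeffding's factor `2`, through `2 ≤ d`.
      _ ≤ p := by
        rw [mul_div_assoc', div_le_iff₀ (by positivity)]
        nlinarith
  refine ⟨Badᶜ, hBadm.compl, ?_, fun ω hω w hw => ?_⟩
  · rw [← ofReal_measureReal, probReal_compl_eq_one_sub hBadm]
    exact ENNReal.ofReal_le_ofReal (by linarith)
  · have hω' : ‖∑ t, covDeviation D (v t) (q t ω)‖ ≤ n * η := by
      rw [hBad, Set.mem_compl_iff, Set.mem_ofPred_eq, not_le] at hω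
      exact hω.le
    have h := one_sub_inner_sq_le_of_norm_sum_covDeviation_le hd hn0
      (fun t => hXt t ω) hv hω' (hδ ▸ hδ0) hx hw
    rw [← hδ] at h
    have := h.trans (perturbation_bound_le hlam0 hc hδ0 hV2 hV4 hη2)
    linarith
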